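/- Let $k,m\in\mathbb N$ and let $M_n$ denote the complex $n\times n$ matrices, $M_n^+$ the cone of positive semidefinite ones, and identify $M_n\otimes M_m$ with $M_n(M_m)$, the $n\times n$ matrices over $M_m$. The following matrix orderings on $M_m$ are considered, given by cones in $M_n(M_m)$, $n\ge 1$: \begin{itemize} \item the usual operator system $M_m=B(\mathbb C^m)$: $M_n(M_m)^+$ consists of the matrices that are positive semidefinite in $M_n(M_m)\cong M_{nm}$; \item $\operatorname{OMIN}(M_m)$: $C_n^{\min}$ consists of the $(v_{ij})\in M_n(M_m)$ with $\sum_{i,j}\overline{\lambda_i}\lambda_j v_{ij}\in M_m^+$ for all $\lambda_1,\dots,\lambda_n\in\mathbb C$; \item $\operatorname{OMAX}(M_m)$: $C_n^{\max}$ consists of the $A\in M_n(M_m)$ such that for every $r>0$ the matrix $rI+A$ is a finite sum of tensors $a\otimes v$ with $a\in M_n^+$, $v\in M_m^+$. \end{itemize} For a linear map $\phi:M_k\to M_m$ let $\phi_n:M_n(M_k)\to M_n(M_m)$ be its entrywise application. $\phi$ is completely positive with respect to given matrix orderings if for every $n$ the map $\phi_n$ maps the $n$-th cone of the domain into the $n$-th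 cone of the range. A positive linear functional on $M_n\otimes M_k$ (nonnegative on $M_n(M_k)^+$) is called separable if it is a finite sum of functionals $f\otimes g$ with $f$, $g$ positive linear functionals on $M_n$, $M_k$. $\phi$ is called entanglement breaking if for every $n$ and every state $s$ on $M_n\otimes M_m$ (a positive linear functional with $s(I)=1$) the functional $s\circ\phi_n$ is a separable positive linear functional on $M_n\otimes M_k$. Let $\gamma_n:M_n\to M_n'$ be the linear isomorphism onto the dual space that maps the matrix units $E_{ij}$ to the dual basis, let $\phi'$ be the dual map of $\phi$, and put $\phi^\flat=\gamma_k^{-1}\circ\phi'\circ\gamma_m:M_m\to M_k$. $\phi$ is called co-entanglement breaking if $\phi^\flat$ is entanglement breaking. Then for every linear map $\phi:M_k\to M_m$ the following are equivalent: \begin{itemize} \item[(i)] $\phi:\operatorname{OMIN}(M_k)\to M_m$ is completely positive; \item[(ii)] $\phi$ is entanglement breaking; \item[(iii)] $\phi$ is co-entanglement breaking; \item[(iv)] $\phi:M_k\to\operatorname{OMAX}(M_m)$ is completely positive; \item[(v)] there are $K\ge 0$, positive linear functionals $s_l:M_k\to\mathbb C$ and matrices $P_l\in M_m^+$, $1\le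 l\le K$, with $\phi(X)=\sum_{l=1}^K s_l(X)P_l$ for all $X\in M_k$; \item[(vi)] there are $N\ge 0$ and $k\times m$ matrices $A_l$ of rank one, $1\le l\le N$, with $\phi(X)=\sum_{l=1}^N A_l^*XA_l$ for all $X\in M_k$; \item[(vii)] $\phi:\operatorname{OMIN}(M_k)\to\operatorname{OMAX}(M_m)$ is completely positive. \end{itemize} Empty sums ($K=0$, $N=0$) are zero. -/

import Mathlib

open scoped ComplexOrder

noncomputable section

namespace OpSys

/-- The algebra `M_n` of complex `n × n` matrices. -/
abbrev Mat (n : ℕ) : Type := Matrix (Fin n) (Fin n) ℂ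

/-- The cone `M_n^+` of positive (semidefinite) matrices. -/
def posCone (n : ℕ) : Set (Mat n) := {X | X.PosSemidef}

section General

variable {V W : Type*} [AddCommGroup V] [Module ℂ V] [AddCommGroup W] [Module ℂ W]

/-- A family of subsets `C_n ⊆ M_n(V)`, one for each matrix size. -/
abbrev MatrixCones (V : Type*) : Type _ := ∀ n : ℕ, Set (Matrix (Fin n) (Fin n) V)

/-- The elementary tensor `a ⊗ v`, as the element `(a_{ij} v)_{ij}` of `M_n(V) = M_n ⊗ V`. -/
def elemTensor {n : ℕ} (a : Mat n) (v : V) : Matrix (Fin n) (Fin n) V :=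
  Matrix.of fun i j => a i j • v

/-- `φ : V → W` is completely positive for the matrix cones `C` on `V` and `D` on `W`:
`φ_n(C_n) ⊆ D_n` for all `n`, where `φ_n` applies `φ` entrywise. -/
def IsCompletelyPositive (C : MatrixCones V) (D : MatrixCones W) (φ : V →ₗ[ℂ] W) : Prop :=
  ∀ n : ℕ, ∀ A ∈ C n, (φ.mapMatrix : Matrix (Fin n) (Fin n) V →ₗ[ℂ] _) A ∈ D n

/-- `C_n^min(V)`: the matrices `(v_{ij})` with `∑ conj(c_i) c_j v_{ij} ∈ V⁺` for all scalars `c`. -/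
def cMin (P : Set V) : MatrixCones V := fun n =>
  {A | ∀ c : Fin n → ℂ, ∑ i, ∑ j, (star (c i) * c j) • A i j ∈ P}

/-- `D_n^max(V)`: the finite sums of `a ⊗ v` with `a ∈ M_n^+` and `v ∈ V⁺`. -/
def dMax (P : Set V) : MatrixCones V := fun n =>
  {A | ∃ (q : ℕ) (a : Fin q → Mat n) (v : Fin q → V),
    (∀ l, a l ∈ posCone n) ∧ (∀ l, v l ∈ P) ∧ A = ∑ l, elemTensor (a l) (v l)}

/-- `C_n^max(V)`: the Archimedeanization of `D_n^max(V)` with respect to the unit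
`e_n = diag(e, …, e)`. -/
def cMax (P : Set V) (e : V) : MatrixCones V := fun n =>
  {A | ∀ r : ℝ, 0 < r → (r : ℂ) • Matrix.diagonal (fun _ : Fin n => e) + A ∈ dMax P n}

/-- A linear functional is positive if it is nonnegative (in particular real) on the cone `P`. -/
def IsPositiveFunctional (P : Set V) (f : V →ₗ[ℂ] ℂ) : Prop := ∀ v ∈ P, 0 ≤ f v

/-- A state is a positive functional with value `1` at the unit `e`. -/
def IsState (P : Set V) (e : V) (f : V →ₗ[ℂ] ℂ) : Prop :=
  IsPositiveFunctional P f ∧ f e = 1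

/-- The functional `s ⊗ t` on `M_n(V) = M_n ⊗ V`: it sends `(v_{ij})` to `s((t(v_{ij})))`. -/
def tensorFunctional {n : ℕ} (s : Mat n →ₗ[ℂ] ℂ) (t : V →ₗ[ℂ] ℂ) :
    Matrix (Fin n) (Fin n) V →ₗ[ℂ] ℂ :=
  s ∘ₗ t.mapMatrix

theorem tensorFunctional_elemTensor {n : ℕ} (s : Mat n →ₗ[ℂ] ℂ) (t : V →ₗ[ℂ] ℂ)
    (a : Mat n) (v : V) : tensorFunctional s t (elemTensor a v) = s a * t v := by
  have h : t.mapMatrix (elemTensor a v) = t v • a := by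
    ext i j
    simp [elemTensor, mul_comm]
  simp [tensorFunctional, h, mul_comm]

end General

/-- The matrix cones of the usual operator system `M_m = B(ℂ^m)`: an `n × n` matrix over `M_m` is
positive if it is so as an `nm × nm` complex matrix. -/
def stdCone (m : ℕ) : MatrixCones (Mat m) := fun n =>
  {A | (Matrix.comp (Fin n) (Fin n) (Fin m) (Fin m) ℂ A).PosSemidef}

/-- The matrix cones of `OMIN(M_m)`. -/
def ominCone (m : ℕ) : MatrixCones (Mat m) := cMin (posCone m)

/-- The matrix cones of `OMAX(M_m)`. -/
def omaxCone (m : ℕ) : MatrixCones (Mat m) := cMax (posCone m) 1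

/-- A positive linear functional on `M_n ⊗ M_m = M_n(M_m)` is separable if it is a finite sum of
tensors of positive linear functionals. -/
def IsSeparable {n m : ℕ} (f : Matrix (Fin n) (Fin n) (Mat m) →ₗ[ℂ] ℂ) : Prop :=
  IsPositiveFunctional (stdCone m n) f ∧
    ∃ (q : ℕ) (s : Fin q → Mat n →ₗ[ℂ] ℂ) (t : Fin q → Mat m →ₗ[ℂ] ℂ),
      (∀ l, IsPositiveFunctional (posCone n) (s l)) ∧
      (∀ l, IsPositiveFunctional (posCone m) (t l)) ∧
      f = ∑ l, tensorFunctional (s l) (t l)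

/-- `φ : M_k → M_m` is entanglement breaking if `s ∘ φ_n` is a separable positive linear functional
for every `n` and every state `s` of `M_n ⊗ M_m`. -/
def IsEntanglementBreaking {k m : ℕ} (φ : Mat k →ₗ[ℂ] Mat m) : Prop :=
  ∀ (n : ℕ) (s : Matrix (Fin n) (Fin n) (Mat m) →ₗ[ℂ] ℂ),
    IsState (stdCone m n) 1 s → IsSeparable (s ∘ₗ φ.mapMatrix)

/-- The linear isomorphism `γ_n : M_n → M_n'` that maps the matrix units `E_{ij}` to the dual
basis `δ_{ij}`. -/
def gamma (n : ℕ) : Mat n ≃ₗ[ℂ] Module.Dual ℂ (Mat n) :=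
  (Matrix.stdBasis ℂ (Fin n) (Fin n)).toDualEquiv

/-- `φ^♭ = γ_k⁻¹ ∘ φ' ∘ γ_m : M_m → M_k`, with `φ'` the transpose of `φ`. -/
def flat {k m : ℕ} (φ : Mat k →ₗ[ℂ] Mat m) : Mat m →ₗ[ℂ] Mat k :=
  (gamma k).symm.toLinearMap ∘ₗ φ.dualMap ∘ₗ (gamma m).toLinearMap

/-- `φ` is co-entanglement breaking if `φ^♭` is entanglement breaking. -/
def IsCoEntanglementBreaking {k m : ℕ} (φ : Mat k →ₗ[ℂ] Mat m) : Prop :=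
  IsEntanglementBreaking (flat φ)

end OpSys

end

/-!
The bridge between the conditions is the measure-and-prepare form (v). Such a map sends `C_n^min`
into the separable cone `D_n^max`, and conversely it is enough to recognise its Choi matrix
`(φ(E_ij))_ij` as separable. The separable cone over the matrices is closed, being generated by the
products of pure states, a compact set on which the trace is `1`; hence `OMAX(M_m)` has the cones
`D_n^max`, which settles (iv), since the Choi matrix is the image of the positive matrix of units.

For (i), a nonseparable Choi matrix would be cut off from the separable cone by a functional `F`.
Writing `F(choi φ) = tr(ψ ∘ φ)`, positivity of `F` on elementary tensors says that `ψ : M_m → M_k`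
is positive, so that `choi ψ` lies in `C_m^min(M_k)` and `choi(φ ∘ ψ) = φ_m(choi ψ)` is positive.
Then `F(choi φ) = tr(φ ∘ ψ) ≥ 0`, a contradiction. Entanglement breaking maps satisfy (i) because
positivity in `M_n(M_m)` is tested on vector states, and `φ ↦ φ^♭` is an involution preserving (v).
-/

namespace OpSys

section ConvexGeometry

variable {E : Type*} [AddCommGroup E] [Module ℝ E]

theorem convexHull_eq_image_stdSimplex_prod [FiniteDimensional ℝ E] (S : Set E) :
    convexHull ℝ S = (fun p : (Fin (Module.finrank ℝ E + 1) → ℝ) ×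
        (Fin (Module.finrank ℝ E + 1) → E) => ∑ i, p.1 i • p.2 i) ''
      (stdSimplex ℝ (Fin (Module.finrank ℝ E + 1)) ×ˢ Set.univ.pi fun _ => S) := by
  apply Set.Subset.antisymm
  · intro x hx
    -- Carathéodory gives at most `finrank + 1` points; pad the weights by zero.
    obtain ⟨ι, _, z, w, hz, hind, hw, hw1, rfl⟩ := eq_pos_convex_span_of_mem_convexHull hx
    have hcard : Fintype.card ι ≤ Fintype.card (Fin (Module.finrank ℝ E + 1)) := by
      rw [Fintype.card_fin]
      exact hind.card_le_finrank_succ.trans (Nat.succ_le_succ (Submodule.finrank_le _))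
    obtain ⟨e⟩ := Function.Embedding.nonempty_of_card_le hcard
    have : Nonempty ι := by
      by_contra! h
      simp at hw1
    have hext : ∀ i, i ∉ Set.range e → Function.extend e w 0 i = 0 :=
      fun i hi => Function.extend_apply' _ _ _ hi
    refine ⟨(Function.extend e w 0, z ∘ Function.invFun e),
      ⟨⟨fun i => ?_, ?_⟩, fun i _ => hz ⟨_, rfl⟩⟩, ?_⟩
    · by_cases hi : i ∈ Set.range e
      · obtain ⟨j, rfl⟩ := hi
        simpa only [e.injective.extend_apply] using (hw j).le
      · exact (hext i hi).ge
    · rw [← hw1]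
      exact (Fintype.sum_of_injective e e.injective _ _ hext fun i =>
        (e.injective.extend_apply w 0 i).symm).symm
    · refine (Fintype.sum_of_injective e e.injective _ _ (fun i hi => ?_) fun i => ?_).symm
      · simp only [hext i hi, zero_smul]
      · simp only [e.injective.extend_apply, Function.comp_apply,
          Function.leftInverse_invFun e.injective i]
  · rintro _ ⟨⟨w, z⟩, ⟨⟨hw0, hw1⟩, hz⟩, rfl⟩
    exact (convex_convexHull ℝ S).sum_mem (fun i _ => hw0 i) hw1
      fun i _ => subset_convexHull ℝ S (hz i trivial)

theorem mem_hull_iff_exists_smul_mem_convexHull {S : Set E} (hS : S.Nonempty) {x : E} :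
    x ∈ PointedCone.hull ℝ S ↔ ∃ t : ℝ, 0 ≤ t ∧ ∃ y ∈ convexHull ℝ S, t • y = x := by
  constructor
  · intro hx
    induction hx using Submodule.span_induction with
    | mem x hx => exact ⟨1, zero_le_one, x, subset_convexHull ℝ S hx, one_smul ℝ x⟩
    | zero =>
      obtain ⟨y, hy⟩ := hS
      exact ⟨0, le_rfl, y, subset_convexHull ℝ S hy, zero_smul ℝ y⟩
    | add x y _ _ hx hy =>
      obtain ⟨t, ht, a, ha, rfl⟩ := hx
      obtain ⟨u, hu, b, hb, rfl⟩ := hy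
      exact ⟨t + u, add_nonneg ht hu,
        (convex_convexHull ℝ S).exists_mem_add_smul_eq ha hb ht hu⟩
    | smul r x _ hx =>
      obtain ⟨t, ht, y, hy, rfl⟩ := hx
      exact ⟨r * t, mul_nonneg r.2 ht, y, hy, mul_smul _ _ _⟩
  · rintro ⟨t, ht, y, hy, rfl⟩
    exact (PointedCone.hull ℝ S).smul_mem ht
      (convexHull_min PointedCone.subset_hull (PointedCone.convex _) hy)

variable [TopologicalSpace E] [ContinuousSMul ℝ E]

theorem isCompact_convexHull [ContinuousAdd E] [FiniteDimensional ℝ E] {S : Set E}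
    (hS : IsCompact S) : IsCompact (convexHull ℝ S) := by
  rw [convexHull_eq_image_stdSimplex_prod]
  exact ((isCompact_stdSimplex ℝ _).prod (isCompact_univ_pi fun _ => hS)).image (by fun_prop)

theorem isClosed_setOf_exists_nonneg_smul [T2Space E] {K : Set E} (hK : IsCompact K)
    {τ : E →ₗ[ℝ] ℝ} (hτ : Continuous τ) (hτK : ∀ x ∈ K, τ x = 1) :
    IsClosed {x | ∃ t : ℝ, 0 ≤ t ∧ ∃ y ∈ K, t • y = x} := by
  refine isClosed_of_closure_subset fun x hx => ?_
  -- Near `x` the coefficient `t = τ (t • y)` stays below `τ x + 1`.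
  have hT : IsCompact ((fun p : ℝ × E => p.1 • p.2) '' (Set.Icc 0 (τ x + 1) ×ˢ K)) :=
    (isCompact_Icc.prod hK).image (by fun_prop)
  have hU : IsOpen {y | τ y < τ x + 1} := isOpen_lt hτ continuous_const
  have hsub : {y | τ y < τ x + 1} ∩ {y | ∃ t : ℝ, 0 ≤ t ∧ ∃ z ∈ K, t • z = y} ⊆
      (fun p : ℝ × E => p.1 • p.2) '' (Set.Icc 0 (τ x + 1) ×ˢ K) := by
    rintro _ ⟨hy : τ _ < τ x + 1, t, ht, z, hz, rfl⟩
    rw [map_smul, hτK z hz, smul_eq_mul, mul_one] at hy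
    exact ⟨(t, z), ⟨⟨ht, hy.le⟩, hz⟩, rfl⟩
  obtain ⟨⟨t, y⟩, ⟨⟨ht, -⟩, hy⟩, rfl⟩ :=
    hT.isClosed.closure_subset_iff.2 hsub (hU.inter_closure ⟨lt_add_one (τ x), hx⟩)
  exact ⟨t, ht, y, hy, rfl⟩

theorem isClosed_hull_of_isCompact [ContinuousAdd E] [T2Space E] [FiniteDimensional ℝ E]
    {S : Set E} (hS : IsCompact S) {τ : E →ₗ[ℝ] ℝ} (hτ : Continuous τ) (hτS : ∀ x ∈ S, τ x = 1) :
    IsClosed (PointedCone.hull ℝ S : Set E) := by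
  rcases S.eq_empty_or_nonempty with rfl | hne
  · simp [PointedCone.hull]
  have hhull : (PointedCone.hull ℝ S : Set E) =
      {x | ∃ t : ℝ, 0 ≤ t ∧ ∃ y ∈ convexHull ℝ S, t • y = x} :=
    Set.ext fun _ => mem_hull_iff_exists_smul_mem_convexHull hne
  rw [hhull]
  exact isClosed_setOf_exists_nonneg_smul (isCompact_convexHull hS) hτ
    (convexHull_min hτS ((convex_singleton (1 : ℝ)).linear_preimage τ))

end ConvexGeometry

section Separation

variable {V : Type*} [AddCommGroup V] [Module ℂ V] [StarAddMonoid V] [StarModule ℂ V]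
  [Module ℝ V] [IsScalarTower ℝ ℂ V] [StarModule ℝ V]

theorem exists_dual_eq_ofReal_of_isSelfAdjoint (f : V →ₗ[ℝ] ℝ) :
    ∃ F : V →ₗ[ℂ] ℂ, ∀ x, IsSelfAdjoint x → F x = f x := by
  refine ⟨Module.Dual.extendRCLike
    (f ∘ₗ (selfAdjoint.submodule ℝ V).subtype ∘ₗ selfAdjointPart ℝ), fun x hx => ?_⟩
  have hskew : Complex.I • x ∈ skewAdjoint V := by
    simp [skewAdjoint.mem_iff, star_smul, hx.star_eq]
  have hIx : selfAdjointPart ℝ (Complex.I • x) = 0 :=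
    LinearMap.congr_fun (selfAdjointPart_comp_subtype_skewAdjoint ℝ) ⟨_, hskew⟩
  change (f (selfAdjointPart ℝ x : V) -
    Complex.I * f (selfAdjointPart ℝ (Complex.I • x) : V) : ℂ) = _
  rw [hx.coe_selfAdjointPart_apply ℝ, hIx]
  simp

theorem exists_dual_of_notMem_properCone
    [TopologicalSpace V] [IsTopologicalAddGroup V] [ContinuousSMul ℝ V] [LocallyConvexSpace ℝ V]
    {C : ProperCone ℝ V} (hC : ∀ y ∈ C, IsSelfAdjoint y) {x : V} (hx : IsSelfAdjoint x)
    (hxC : x ∉ C) : ∃ F : V →ₗ[ℂ] ℂ, (∀ y ∈ C, 0 ≤ F y) ∧ F x < 0 := by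
  obtain ⟨f, hf, hfx⟩ := C.hyperplane_separation_point hxC
  obtain ⟨F, hF⟩ := exists_dual_eq_ofReal_of_isSelfAdjoint f.toLinearMap
  refine ⟨F, fun y hy => ?_, ?_⟩
  · rw [hF y (hC y hy)]
    exact Complex.zero_le_real.2 (hf y hy)
  · rw [hF x hx]
    exact_mod_cast hfx

end Separation

section PureStates

/-- The rank-one projections in `M_n`, i.e. the pure states viewed as density matrices: a compact
set of matrices of trace one that generates the cone `M_n^+`. -/
def pureStates (n : ℕ) : Set (Mat n) :=
  (fun x : EuclideanSpace ℂ (Fin n) => Matrix.vecMulVec x.ofLp (star x.ofLp)) ''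
    Metric.sphere 0 1

theorem isCompact_pureStates (n : ℕ) : IsCompact (pureStates n) :=
  (isCompact_sphere _ _).image (by fun_prop)

theorem trace_eq_one_of_mem_pureStates {n : ℕ} {a : Mat n} (ha : a ∈ pureStates n) :
    a.trace = 1 := by
  obtain ⟨x, hx, rfl⟩ := ha
  rw [Matrix.trace_vecMulVec, ← EuclideanSpace.inner_eq_star_dotProduct,
    inner_self_eq_norm_sq_to_K, mem_sphere_zero_iff_norm.1 hx]
  simp

theorem vecMulVec_self_star_mem_hull_pureStates {n : ℕ} (x : Fin n → ℂ) :
    Matrix.vecMulVec x (star x) ∈ PointedCone.hull ℝ (pureStates n) := by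
  rcases eq_or_ne (WithLp.toLp 2 x) 0 with hx | hx
  · obtain rfl : x = 0 := by simpa using hx
    simp
  have hnorm : ‖WithLp.toLp 2 x‖ ≠ 0 := norm_ne_zero_iff.2 hx
  have hsphere : ‖WithLp.toLp 2 x‖⁻¹ • WithLp.toLp 2 x ∈ Metric.sphere 0 1 := by
    rw [mem_sphere_zero_iff_norm, norm_smul, norm_inv, norm_norm, inv_mul_cancel₀ hnorm]
  have hnormalize : Matrix.vecMulVec x (star x) = ‖WithLp.toLp 2 x‖ ^ 2 •
      Matrix.vecMulVec (‖WithLp.toLp 2 x‖⁻¹ • x) (star (‖WithLp.toLp 2 x‖⁻¹ • x)) := by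
    have hcancel : ‖WithLp.toLp 2 x‖ ^ 2 * ‖WithLp.toLp 2 x‖⁻¹ * ‖WithLp.toLp 2 x‖⁻¹ = 1 := by
      field_simp
    rw [star_smul, Matrix.smul_vecMulVec, Matrix.vecMulVec_smul, smul_smul, smul_smul,
      star_trivial ‖WithLp.toLp 2 x‖⁻¹, hcancel, one_smul]
  rw [hnormalize]
  exact PointedCone.smul_mem _ (sq_nonneg _) (PointedCone.subset_hull ⟨_, hsphere, rfl⟩)

theorem posCone_eq_hull_pureStates (n : ℕ) : posCone n = PointedCone.hull ℝ (pureStates n) := by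
  apply Set.Subset.antisymm
  · intro a ha
    obtain ⟨d, x, rfl⟩ := Matrix.posSemidef_iff_eq_sum_vecMulVec.1 ha
    exact Submodule.sum_mem _ fun i _ => vecMulVec_self_star_mem_hull_pureStates (x i)
  · intro a ha
    induction ha using Submodule.span_induction with
    | mem a ha =>
      obtain ⟨x, -, rfl⟩ := ha
      exact Matrix.posSemidef_vecMulVec_self_star x
    | zero => exact Matrix.PosSemidef.zero
    | add a b _ _ ha hb => exact ha.add hb
    | smul r a _ ha => exact ha.smul r.2

end PureStates

section MaximalCone

variable {V : Type*} [AddCommGroup V] [Module ℂ V]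

theorem trace_elemTensor {n : ℕ} (a : Mat n) (v : V) :
    (elemTensor a v).trace = a.trace • v :=
  (Finset.sum_smul ..).symm

variable [Module ℝ V] [IsScalarTower ℝ ℂ V]

theorem dMax_eq_hull (P : Set V) (n : ℕ) :
    dMax P n = PointedCone.hull ℝ (Set.image2 elemTensor (posCone n) P) := by
  apply Set.Subset.antisymm
  · rintro _ ⟨q, a, v, ha, hv, rfl⟩
    exact Submodule.sum_mem _ fun l _ =>
      PointedCone.subset_hull (Set.mem_image2_of_mem (ha l) (hv l))
  · intro A hA
    obtain ⟨q, r, B, rfl⟩ := Submodule.mem_span_set'.1 hA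
    choose a ha v hv hav using fun l => (B l).2
    refine ⟨q, fun l => (r l : ℝ) • a l, v, fun l => (ha l).smul (r l).2, hv, ?_⟩
    refine Finset.sum_congr rfl fun l _ => ?_
    rw [← hav l]
    ext i j
    exact (smul_assoc (r l : ℝ) (a l i j) (v l)).symm

theorem dMax_hull (S : Set V) (n : ℕ) :
    dMax (PointedCone.hull ℝ S : Set V) n =
      PointedCone.hull ℝ (Set.image2 elemTensor (pureStates n) S) := by
  let f : Mat n →ₗ[{c : ℝ // 0 ≤ c}] V →ₗ[{c : ℝ // 0 ≤ c}] Matrix (Fin n) (Fin n) V :=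
    LinearMap.mk₂ _ elemTensor
      (fun a b v => by ext i j; exact add_smul _ _ _)
      (fun c a v => by ext i j; exact smul_assoc (c : ℝ) _ _)
      (fun a v w => by ext i j; exact smul_add _ _ _)
      (fun c a v => by ext i j; exact smul_comm (a i j) (c : ℝ) v)
  rw [dMax_eq_hull, posCone_eq_hull_pureStates]
  exact congrArg _
    ((Submodule.map₂_eq_span_image2 f _ _).symm.trans (Submodule.map₂_span_span _ f _ _))

theorem isClosed_dMax_hull [TopologicalSpace V] [IsTopologicalAddGroup V] [ContinuousSMul ℝ V]
    [ContinuousSMul ℂ V] [T2Space V] [FiniteDimensional ℝ V] {S : Set V} (hS : IsCompact S)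
    {τ : V →ₗ[ℝ] ℝ} (hτ : Continuous τ) (hτS : ∀ v ∈ S, τ v = 1) (n : ℕ) :
    IsClosed (dMax (PointedCone.hull ℝ S : Set V) n) := by
  rw [dMax_hull]
  refine isClosed_hull_of_isCompact (τ := τ ∘ₗ Matrix.traceLinearMap (Fin n) ℝ V) ?_ ?_ ?_
  · rw [← Set.image_uncurry_prod]
    refine ((isCompact_pureStates n).prod hS).image ?_
    unfold elemTensor Function.uncurry
    fun_prop
  · exact hτ.comp (Continuous.matrix_trace continuous_id)
  · rintro _ ⟨a, ha, v, hv, rfl⟩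
    rw [LinearMap.comp_apply, Matrix.traceLinearMap_apply, trace_elemTensor,
      trace_eq_one_of_mem_pureStates ha, one_smul, hτS v hv]

end MaximalCone

theorem isClosed_dMax_posCone (n m : ℕ) : IsClosed (dMax (posCone m) n) := by
  rw [posCone_eq_hull_pureStates]
  refine isClosed_dMax_hull (isCompact_pureStates m)
    (τ := Complex.reLm ∘ₗ Matrix.traceLinearMap (Fin m) ℝ ℂ) ?_ (fun a ha => ?_) n
  · exact Complex.continuous_re.comp (Continuous.matrix_trace continuous_id)
  · simp [trace_eq_one_of_mem_pureStates ha]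

section UnitalMaximalCone

variable {V : Type*} [AddCommGroup V] [Module ℂ V]

theorem elemTensor_mem_dMax {P : Set V} {n : ℕ} {a : Mat n} {v : V} (ha : a ∈ posCone n)
    (hv : v ∈ P) : elemTensor a v ∈ dMax P n :=
  ⟨1, fun _ => a, fun _ => v, fun _ => ha, fun _ => hv, by simp⟩

theorem add_mem_dMax [Module ℝ V] [IsScalarTower ℝ ℂ V] {P : Set V} {n : ℕ}
    {A B : Matrix (Fin n) (Fin n) V} (hA : A ∈ dMax P n) (hB : B ∈ dMax P n) :
    A + B ∈ dMax P n := by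
  rw [dMax_eq_hull] at *
  exact Submodule.add_mem _ hA hB

theorem smul_diagonal_mem_dMax {P : Set V} {e : V} (he : e ∈ P) (n : ℕ) {r : ℝ} (hr : 0 ≤ r) :
    (r : ℂ) • Matrix.diagonal (fun _ : Fin n => e) ∈ dMax P n := by
  have hdiag : (r : ℂ) • Matrix.diagonal (fun _ : Fin n => e) =
      elemTensor (r • (1 : Mat n)) e := by
    ext i j
    by_cases h : i = j <;> simp [elemTensor, Matrix.one_apply, h]
  rw [hdiag]
  exact elemTensor_mem_dMax (Matrix.PosSemidef.one.smul hr) he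

theorem cMax_eq_dMax [Module ℝ V] [IsScalarTower ℝ ℂ V] [TopologicalSpace V] [ContinuousAdd V]
    [ContinuousSMul ℂ V] {P : Set V} {e : V} {n : ℕ} (hP : IsClosed (dMax P n)) (he : e ∈ P) :
    cMax P e n = dMax P n := by
  refine Set.Subset.antisymm (fun A hA => ?_) fun A hA r hr =>
    add_mem_dMax (smul_diagonal_mem_dMax he n hr.le) hA
  have hcont : Continuous fun r : ℝ => (r : ℂ) • Matrix.diagonal (fun _ : Fin n => e) + A := by
    fun_prop
  have hlim := (hcont.tendsto 0).mono_left (nhdsWithin_le_nhds (s := Set.Ioi 0))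
  rw [Complex.ofReal_zero, zero_smul, zero_add] at hlim
  exact hP.mem_of_tendsto hlim (Filter.eventually_of_mem self_mem_nhdsWithin hA)

end UnitalMaximalCone

theorem omaxCone_eq_dMax (m : ℕ) : omaxCone m = dMax (posCone m) :=
  funext fun n => cMax_eq_dMax (isClosed_dMax_posCone n m) Matrix.PosSemidef.one

theorem isSelfAdjoint_of_mem_stdCone {n m : ℕ} {A : Matrix (Fin n) (Fin n) (Mat m)}
    (hA : A ∈ stdCone m n) : IsSelfAdjoint A := by
  ext i j p q
  exact (Matrix.PosSemidef.isHermitian hA).apply (i, p) (j, q)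

theorem dMax_posCone_subset_stdCone (n m : ℕ) : dMax (posCone m) n ⊆ stdCone m n := by
  rintro _ ⟨q, a, v, ha, hv, rfl⟩
  exact Finset.sum_induction _ (· ∈ stdCone m n) (fun _ _ => Matrix.PosSemidef.add)
    Matrix.PosSemidef.zero fun l _ => Matrix.PosSemidef.kronecker (ha l) (hv l)

theorem exists_dual_of_notMem_dMax {n m : ℕ} {A : Matrix (Fin n) (Fin n) (Mat m)}
    (hA : IsSelfAdjoint A) (hAd : A ∉ dMax (posCone m) n) :
    ∃ F : Matrix (Fin n) (Fin n) (Mat m) →ₗ[ℂ] ℂ,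
      IsPositiveFunctional (dMax (posCone m) n) F ∧ F A < 0 := by
  have : LocallyConvexSpace ℝ (Matrix (Fin n) (Fin n) (Mat m)) :=
    inferInstanceAs (LocallyConvexSpace ℝ (Fin n → Fin n → Fin m → Fin m → ℂ))
  have hcone := dMax_eq_hull (posCone m) n
  let C : ProperCone ℝ (Matrix (Fin n) (Fin n) (Mat m)) :=
    ⟨PointedCone.hull ℝ (Set.image2 elemTensor (posCone n) (posCone m)),
      (congrArg IsClosed hcone).mp (isClosed_dMax_posCone n m)⟩
  have hmem : ∀ B, B ∈ C ↔ B ∈ dMax (posCone m) n := fun B => by rw [hcone]; rfl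
  obtain ⟨F, hF, hFA⟩ := exists_dual_of_notMem_properCone (C := C)
    (fun B hB => isSelfAdjoint_of_mem_stdCone (dMax_posCone_subset_stdCone n m ((hmem B).1 hB)))
    hA (mt (hmem A).1 hAd)
  exact ⟨F, fun B hB => hF B ((hmem B).2 hB), hFA⟩

section PositiveFunctionals

open scoped Matrix

theorem posSemidef_iff_forall_dotProduct_nonneg {ι : Type*} [Fintype ι] {M : Matrix ι ι ℂ} :
    M.PosSemidef ↔ ∀ x : ι → ℂ, 0 ≤ star x ⬝ᵥ M *ᵥ x := by
  classical
  refine ⟨fun h x => h.dotProduct_mulVec_nonneg x, fun h => ?_⟩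
  rw [← Matrix.isPositive_toEuclideanLin_iff, LinearMap.isPositive_iff_complex]
  intro x
  have hinner : inner ℂ (M.toEuclideanLin x) x = star x.ofLp ⬝ᵥ M *ᵥ x.ofLp := by
    rw [← inner_conj_symm, EuclideanSpace.inner_eq_star_dotProduct, dotProduct_comm]
    exact (IsSelfAdjoint.of_nonneg (h x.ofLp)).star_eq
  rw [hinner]
  obtain ⟨hre, him⟩ := Complex.nonneg_iff.1 (h x.ofLp)
  exact ⟨Complex.ext rfl him, hre⟩

theorem stdCone_subset_ominCone (n m : ℕ) : stdCone m n ⊆ ominCone m n := by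
  intro A hA c
  let B : Matrix (Fin n × Fin m) (Fin m) ℂ := Matrix.of fun i q => c i.1 * (1 : Mat m) i.2 q
  have hB : ∑ i, ∑ j, (star (c i) * c j) • A i j = Bᴴ * Matrix.comp _ _ _ _ ℂ A * B := by
    ext p q
    simp only [B, Matrix.mul_apply, Matrix.sum_apply, Fintype.sum_prod_type, Matrix.one_apply,
      Matrix.smul_apply, Matrix.conjTranspose_apply, Matrix.of_apply, Matrix.comp_apply,
      smul_eq_mul, Finset.sum_mul, mul_ite, ite_mul, mul_one, mul_zero, zero_mul, apply_ite star,
      star_zero, Finset.sum_ite_eq', Finset.mem_univ, if_true]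
    rw [Finset.sum_comm]
    simp only [mul_right_comm]
  rw [hB]
  exact Matrix.PosSemidef.conjTranspose_mul_mul_same hA B

section General

variable {V : Type*} [AddCommGroup V] [Module ℂ V] {P : Set V}

theorem IsPositiveFunctional.mapMatrix_mem_posCone {n : ℕ} {t : V →ₗ[ℂ] ℂ}
    (ht : IsPositiveFunctional P t) {A : Matrix (Fin n) (Fin n) V} (hA : A ∈ cMin P n) :
    t.mapMatrix A ∈ posCone n := by
  refine posSemidef_iff_forall_dotProduct_nonneg.2 fun c => ?_
  have hform : star c ⬝ᵥ t.mapMatrix A *ᵥ c = t (∑ i, ∑ j, (star (c i) * c j) • A i j) := by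
    simp only [map_sum, map_smul, smul_eq_mul, dotProduct, Matrix.mulVec, Finset.mul_sum,
      Pi.star_apply, LinearMap.mapMatrix_apply, Matrix.map_apply, mul_assoc, mul_comm (c _)]
  rw [hform]
  exact ht _ (hA c)

theorem IsPositiveFunctional.tensorFunctional {n : ℕ} {s : Mat n →ₗ[ℂ] ℂ} {t : V →ₗ[ℂ] ℂ}
    (hs : IsPositiveFunctional (posCone n) s) (ht : IsPositiveFunctional P t) :
    IsPositiveFunctional (cMin P n) (tensorFunctional s t) :=
  fun _ hA => hs _ (ht.mapMatrix_mem_posCone hA)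

theorem IsPositiveFunctional.sum {ι : Type*} [Fintype ι] {f : ι → V →ₗ[ℂ] ℂ}
    (hf : ∀ l, IsPositiveFunctional P (f l)) : IsPositiveFunctional P (∑ l, f l) := fun v hv => by
  rw [LinearMap.sum_apply]
  exact Finset.sum_nonneg fun l _ => hf l v hv

end General

/-- The functional `A ↦ ⟨x, A x⟩` on `M_n(M_m)`, a multiple of a pure state of `M_n ⊗ M_m`. -/
def vectorFunctional {n m : ℕ} (x : Fin n × Fin m → ℂ) :
    Matrix (Fin n) (Fin n) (Mat m) →ₗ[ℂ] ℂ where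
  toFun A := star x ⬝ᵥ Matrix.comp _ _ _ _ ℂ A *ᵥ x
  map_add' A B := by
    rw [← dotProduct_add, ← Matrix.add_mulVec]
    rfl
  map_smul' c A := by
    rw [RingHom.id_apply, ← dotProduct_smul, ← Matrix.smul_mulVec]
    rfl

theorem vectorFunctional_one {n m : ℕ} (x : Fin n × Fin m → ℂ) :
    vectorFunctional x 1 = star x ⬝ᵥ x := by
  change star x ⬝ᵥ Matrix.comp _ _ _ _ ℂ 1 *ᵥ x = star x ⬝ᵥ x
  rw [Matrix.comp_one, Matrix.one_mulVec]

theorem isPositiveFunctional_vectorFunctional {n m : ℕ} (x : Fin n × Fin m → ℂ) :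
    IsPositiveFunctional (stdCone m n) (vectorFunctional x) :=
  fun _ hA => Matrix.PosSemidef.dotProduct_mulVec_nonneg hA x

theorem mem_stdCone_iff_forall_vectorFunctional_nonneg {n m : ℕ}
    {A : Matrix (Fin n) (Fin n) (Mat m)} :
    A ∈ stdCone m n ↔ ∀ x, 0 ≤ vectorFunctional x A :=
  posSemidef_iff_forall_dotProduct_nonneg

theorem IsEntanglementBreaking.isCompletelyPositive_ominCone_stdCone {k m : ℕ}
    {φ : Mat k →ₗ[ℂ] Mat m} (h : IsEntanglementBreaking φ) :
    IsCompletelyPositive (ominCone k) (stdCone m) φ := by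
  intro n A hA
  refine mem_stdCone_iff_forall_vectorFunctional_nonneg.2 fun x => ?_
  rcases eq_or_ne x 0 with rfl | hx
  · simp [vectorFunctional]
  have hpos : 0 < star x ⬝ᵥ x := Matrix.dotProduct_star_self_pos_iff.2 hx
  have hstate : IsState (stdCone m n) 1 ((star x ⬝ᵥ x)⁻¹ • vectorFunctional x) := by
    refine ⟨fun B hB => ?_, ?_⟩
    · exact mul_nonneg (inv_nonneg.2 hpos.le) (isPositiveFunctional_vectorFunctional x B hB)
    · rw [LinearMap.smul_apply, vectorFunctional_one, smul_eq_mul, inv_mul_cancel₀ hpos.ne']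
  obtain ⟨-, q, s, t, hs, ht, heq⟩ := h n _ hstate
  have hsep : 0 ≤ (((star x ⬝ᵥ x)⁻¹ • vectorFunctional x) ∘ₗ φ.mapMatrix) A := by
    rw [heq]
    exact IsPositiveFunctional.sum (fun l => (hs l).tensorFunctional (ht l)) A hA
  rw [LinearMap.smul_comp, LinearMap.smul_apply, smul_eq_mul] at hsep
  have hmul := mul_nonneg hpos.le hsep
  rwa [mul_inv_cancel_left₀ hpos.ne'] at hmul

end PositiveFunctionals

section Gamma

theorem gamma_single {n : ℕ} (a : Mat n) (i j : Fin n) :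
    gamma n a (Matrix.single i j 1) = a i j := by
  rw [← Matrix.stdBasis_eq_single]
  exact Module.Basis.toDual_eq_repr _ _ _

theorem gamma_apply {n : ℕ} (a b : Mat n) : gamma n a b = ∑ i, ∑ j, a i j * b i j := by
  have hb : b = ∑ i, ∑ j, b i j • Matrix.single i j 1 := by
    simpa only [Matrix.smul_single, smul_eq_mul, mul_one] using Matrix.matrix_eq_sum_single b
  conv_lhs => rw [hb]
  simp only [map_sum, map_smul, gamma_single, smul_eq_mul, mul_comm]

theorem gamma_comm {n : ℕ} (a b : Mat n) : gamma n a b = gamma n b a := by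
  simp only [gamma_apply, mul_comm]

theorem isPositiveFunctional_gamma_iff {n : ℕ} {a : Mat n} :
    IsPositiveFunctional (posCone n) (gamma n a) ↔ a ∈ posCone n := by
  refine ⟨fun h => posSemidef_iff_forall_dotProduct_nonneg.2 fun x => ?_, fun h b hb => ?_⟩
  · have hx := h _ (Matrix.posSemidef_vecMulVec_star_self x)
    simpa only [gamma_apply, Matrix.vecMulVec_apply, dotProduct, Matrix.mulVec, Finset.mul_sum,
      mul_left_comm] using hx
  · have hab := (Matrix.PosSemidef.hadamard h hb).dotProduct_mulVec_nonneg 1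
    simpa [gamma_apply, dotProduct, Matrix.mulVec] using hab

theorem gamma_flat {k m : ℕ} (φ : Mat k →ₗ[ℂ] Mat m) (b : Mat m) (a : Mat k) :
    gamma k (flat φ b) a = gamma m b (φ a) := by
  rw [flat, LinearMap.comp_apply, LinearEquiv.coe_coe, LinearEquiv.apply_symm_apply]
  rfl

theorem flat_flat {k m : ℕ} (φ : Mat k →ₗ[ℂ] Mat m) : flat (flat φ) = φ := by
  refine LinearMap.ext fun a => (gamma m).injective (LinearMap.ext fun b => ?_)
  rw [gamma_flat, gamma_comm, gamma_flat, gamma_comm]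

end Gamma

section MeasureAndPrepare

variable {V W : Type*} [AddCommGroup V] [Module ℂ V] [AddCommGroup W] [Module ℂ W]

/-- `φ : V → W` is a measure-and-prepare map if it is a finite sum of maps `x ↦ s(x) w` with `s` a
positive functional for the cone `P` of `V` and `w` in the cone `Q` of `W`, as in condition (v). -/
def IsMeasureAndPrepare (P : Set V) (Q : Set W) (φ : V →ₗ[ℂ] W) : Prop :=
  ∃ (K : ℕ) (s : Fin K → V →ₗ[ℂ] ℂ) (w : Fin K → W),
    (∀ l, IsPositiveFunctional P (s l)) ∧ (∀ l, w l ∈ Q) ∧ ∀ x, φ x = ∑ l, s l x • w l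

theorem mapMatrix_eq_sum_elemTensor {K n : ℕ} {φ : V →ₗ[ℂ] W} {s : Fin K → V →ₗ[ℂ] ℂ}
    {w : Fin K → W} (hφ : ∀ x, φ x = ∑ l, s l x • w l) (A : Matrix (Fin n) (Fin n) V) :
    φ.mapMatrix A = ∑ l, elemTensor ((s l).mapMatrix A) (w l) := by
  ext i j
  rw [LinearMap.mapMatrix_apply, Matrix.map_apply, hφ, Matrix.sum_apply]
  rfl

theorem IsMeasureAndPrepare.isCompletelyPositive_cMin_dMax {P : Set V} {Q : Set W}
    {φ : V →ₗ[ℂ] W} (h : IsMeasureAndPrepare P Q φ) :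
    IsCompletelyPositive (cMin P) (dMax Q) φ := by
  obtain ⟨K, s, w, hs, hw, hφ⟩ := h
  exact fun n A hA =>
    ⟨K, _, w, fun l => (hs l).mapMatrix_mem_posCone hA, hw, mapMatrix_eq_sum_elemTensor hφ A⟩

theorem IsMeasureAndPrepare.isEntanglementBreaking {k m : ℕ} {φ : Mat k →ₗ[ℂ] Mat m}
    (h : IsMeasureAndPrepare (posCone k) (posCone m) φ) : IsEntanglementBreaking φ := by
  obtain ⟨K, s, w, hs, hw, hφ⟩ := h
  intro n f hf
  let tensorRight (l : Fin K) : Mat n →ₗ[ℂ] Matrix (Fin n) (Fin n) (Mat m) :=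
    (LinearMap.toSpanSingleton ℂ (Mat m) (w l)).mapMatrix
  have hf' : ∀ l, IsPositiveFunctional (posCone n) (f ∘ₗ tensorRight l) := fun l a ha =>
    hf.1 _ (dMax_posCone_subset_stdCone n m (elemTensor_mem_dMax ha (hw l)))
  have heq : f ∘ₗ φ.mapMatrix = ∑ l, tensorFunctional (f ∘ₗ tensorRight l) (s l) := by
    refine LinearMap.ext fun A => ?_
    rw [LinearMap.comp_apply, mapMatrix_eq_sum_elemTensor hφ, map_sum, LinearMap.sum_apply]
    rfl
  refine ⟨?_, K, _, s, hf', hs, heq⟩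
  rw [heq]
  exact fun A hA => IsPositiveFunctional.sum (fun l => (hf' l).tensorFunctional (hs l)) A
    (stdCone_subset_ominCone n k hA)

theorem IsMeasureAndPrepare.flat {k m : ℕ} {φ : Mat k →ₗ[ℂ] Mat m}
    (h : IsMeasureAndPrepare (posCone k) (posCone m) φ) :
    IsMeasureAndPrepare (posCone m) (posCone k) (flat φ) := by
  obtain ⟨K, s, w, hs, hw, hφ⟩ := h
  refine ⟨K, fun l => gamma m (w l), fun l => (gamma k).symm (s l),
    fun l => isPositiveFunctional_gamma_iff.2 (hw l), fun l => ?_, fun b => ?_⟩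
  · rw [← isPositiveFunctional_gamma_iff, LinearEquiv.apply_symm_apply]
    exact hs l
  · refine (gamma k).injective (LinearMap.ext fun a => ?_)
    rw [gamma_flat, hφ]
    simp only [map_sum, map_smul, smul_eq_mul, LinearEquiv.apply_symm_apply, LinearMap.sum_apply,
      LinearMap.smul_apply, gamma_comm b, mul_comm]

end MeasureAndPrepare

section Choi

variable {V W : Type*} [AddCommGroup V] [Module ℂ V] [AddCommGroup W] [Module ℂ W]

/-- The Choi matrix `(φ(E_{ij}))_{ij} ∈ M_k(V)` of a linear map `φ : M_k → V`. -/
def choi {k : ℕ} (φ : Mat k →ₗ[ℂ] V) : Matrix (Fin k) (Fin k) V :=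
  Matrix.of fun i j => φ (Matrix.single i j 1)

theorem mapMatrix_choi {k : ℕ} (φ : V →ₗ[ℂ] W) (ψ : Mat k →ₗ[ℂ] V) :
    φ.mapMatrix (choi ψ) = choi (φ ∘ₗ ψ) :=
  rfl

theorem isMeasureAndPrepare_of_choi_mem_dMax {P : Set V} {k : ℕ} {φ : Mat k →ₗ[ℂ] V}
    (h : choi φ ∈ dMax P k) : IsMeasureAndPrepare (posCone k) P φ := by
  obtain ⟨K, a, v, ha, hv, hφ⟩ := h
  refine ⟨K, fun l => gamma k (a l), v, fun l => isPositiveFunctional_gamma_iff.2 (ha l), hv, ?_⟩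
  have heq : φ = ∑ l, (gamma k (a l)).smulRight (v l) := by
    refine Matrix.ext_linearMap ℂ fun i j => LinearMap.ext_ring ?_
    have hij : φ (Matrix.single i j 1) = (∑ l, elemTensor (a l) (v l)) i j := congrFun₂ hφ i j
    rw [Matrix.sum_apply] at hij
    simpa [gamma_single, elemTensor] using hij
  intro x
  rw [heq, LinearMap.sum_apply]
  rfl

theorem choi_mem_cMin {P : Set V} {k : ℕ} {ψ : Mat k →ₗ[ℂ] V} (hψ : Set.MapsTo ψ (posCone k) P) :
    choi ψ ∈ cMin P k := by
  intro c
  have hc : ∑ i, ∑ j, (star (c i) * c j) • choi ψ i j = ψ (Matrix.vecMulVec (star c) c) := by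
    conv_rhs => rw [Matrix.matrix_eq_sum_single (Matrix.vecMulVec (star c) c)]
    simp only [choi, Matrix.of_apply, map_sum, ← map_smul, Matrix.smul_single, smul_eq_mul, mul_one,
      Matrix.vecMulVec_apply, Pi.star_apply]
  rw [hc]
  exact hψ (Matrix.posSemidef_vecMulVec_star_self c)

/-- The unnormalised maximally entangled vector `Ω = ∑ e_i ⊗ e_i`, for which `Ω Ω*` is the Choi
matrix of the identity of `M_k`. -/
def maxEntangled (k : ℕ) : Fin k × Fin k → ℂ := fun i => if i.1 = i.2 then 1 else 0

theorem choi_id_mem_stdCone (k : ℕ) : choi (LinearMap.id : Mat k →ₗ[ℂ] Mat k) ∈ stdCone k k := by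
  have hcomp : Matrix.comp _ _ _ _ ℂ (choi (LinearMap.id : Mat k →ₗ[ℂ] Mat k)) =
      Matrix.vecMulVec (maxEntangled k) (star (maxEntangled k)) := by
    ext ⟨i, p⟩ ⟨j, q⟩
    by_cases hi : i = p <;> by_cases hj : j = q <;>
      simp [choi, maxEntangled, Matrix.vecMulVec_apply, hi, hj]
  change (Matrix.comp _ _ _ _ ℂ _).PosSemidef
  rw [hcomp]
  exact Matrix.posSemidef_vecMulVec_self_star _

theorem trace_eq_sum_apply_single {k : ℕ} (χ : Mat k →ₗ[ℂ] Mat k) :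
    LinearMap.trace ℂ (Mat k) χ = ∑ i, ∑ j, χ (Matrix.single i j 1) i j := by
  rw [LinearMap.trace_eq_matrix_trace ℂ (Matrix.stdBasis ℂ (Fin k) (Fin k)), Matrix.trace,
    Fintype.sum_prod_type]
  refine Finset.sum_congr rfl fun i _ => Finset.sum_congr rfl fun j _ => ?_
  rw [Matrix.diag_apply, LinearMap.toMatrix_apply, Matrix.stdBasis_eq_single]
  exact (Module.Basis.toDual_eq_repr _ _ _).symm.trans
    ((congrArg _ (Matrix.stdBasis_eq_single ..)).trans (gamma_single _ i j))

theorem trace_nonneg_of_choi_mem_stdCone {k : ℕ} {χ : Mat k →ₗ[ℂ] Mat k}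
    (h : choi χ ∈ stdCone k k) : 0 ≤ LinearMap.trace ℂ (Mat k) χ := by
  have hχ : LinearMap.trace ℂ (Mat k) χ =
      vectorFunctional (maxEntangled k) (choi χ) := by
    rw [trace_eq_sum_apply_single]
    simp [vectorFunctional, choi, maxEntangled, dotProduct, Matrix.mulVec, Fintype.sum_prod_type]
  rw [hχ]
  exact isPositiveFunctional_vectorFunctional _ _ h

/-- The map `ψ : V → M_k`, `ψ(v)_{ij} = F(E_{ij} ⊗ v)`, that represents a functional `F` on `M_k(V)`
through the trace pairing `φ ↦ tr(ψ ∘ φ)` with the linear maps `φ : M_k → V`. -/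
def traceDual {k : ℕ} (F : Matrix (Fin k) (Fin k) V →ₗ[ℂ] ℂ) : V →ₗ[ℂ] Mat k where
  toFun v := Matrix.of fun i j => F (Matrix.single i j v)
  map_add' v w := by
    ext i j
    simp [Matrix.single_add]
  map_smul' c v := by
    ext i j
    simp [← Matrix.smul_single]

theorem gamma_traceDual {k : ℕ} (F : Matrix (Fin k) (Fin k) V →ₗ[ℂ] ℂ) (v : V) (a : Mat k) :
    gamma k (traceDual F v) a = F (elemTensor a v) := by
  rw [Matrix.matrix_eq_sum_single (elemTensor a v), gamma_apply]
  simp only [map_sum, traceDual]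
  refine Finset.sum_congr rfl fun i _ => Finset.sum_congr rfl fun j _ => ?_
  simp [elemTensor, ← Matrix.smul_single, mul_comm]

theorem mapsTo_traceDual {P : Set V} {k : ℕ} {F : Matrix (Fin k) (Fin k) V →ₗ[ℂ] ℂ}
    (hF : IsPositiveFunctional (dMax P k) F) : Set.MapsTo (traceDual F) P (posCone k) := by
  refine fun v hv => isPositiveFunctional_gamma_iff.1 fun a ha => ?_
  rw [gamma_traceDual]
  exact hF _ (elemTensor_mem_dMax ha hv)

theorem trace_traceDual_comp {k : ℕ} (F : Matrix (Fin k) (Fin k) V →ₗ[ℂ] ℂ) (φ : Mat k →ₗ[ℂ] V) :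
    LinearMap.trace ℂ (Mat k) (traceDual F ∘ₗ φ) = F (choi φ) := by
  rw [trace_eq_sum_apply_single, Matrix.matrix_eq_sum_single (choi φ)]
  simp only [map_sum]
  rfl

theorem isMeasureAndPrepare_of_isCompletelyPositive_stdCone_dMax {P : Set V} {k : ℕ}
    {φ : Mat k →ₗ[ℂ] V} (h : IsCompletelyPositive (stdCone k) (dMax P) φ) :
    IsMeasureAndPrepare (posCone k) P φ :=
  isMeasureAndPrepare_of_choi_mem_dMax (h k _ (choi_id_mem_stdCone k))

theorem isMeasureAndPrepare_of_isCompletelyPositive_ominCone_stdCone {k m : ℕ}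
    {φ : Mat k →ₗ[ℂ] Mat m} (h : IsCompletelyPositive (ominCone k) (stdCone m) φ) :
    IsMeasureAndPrepare (posCone k) (posCone m) φ := by
  refine isMeasureAndPrepare_of_choi_mem_dMax ?_
  by_contra hφ
  have hstd : choi φ ∈ stdCone m k := h k _ (stdCone_subset_ominCone k k (choi_id_mem_stdCone k))
  obtain ⟨F, hF, hneg⟩ := exists_dual_of_notMem_dMax (isSelfAdjoint_of_mem_stdCone hstd) hφ
  have htrace : 0 ≤ LinearMap.trace ℂ (Mat m) (φ ∘ₗ traceDual F) := by
    refine trace_nonneg_of_choi_mem_stdCone ?_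
    rw [← mapMatrix_choi]
    exact h m _ (choi_mem_cMin (mapsTo_traceDual hF))
  rw [LinearMap.trace_comp_comm', trace_traceDual_comp] at htrace
  exact hneg.not_ge htrace

end Choi

section RankOne

open scoped Matrix

theorem exists_eq_vecMulVec_of_rank_eq_one {ι κ 𝕜 : Type*} [Finite ι] [Fintype κ] [Field 𝕜]
    {A : Matrix ι κ 𝕜} (hA : A.rank = 1) :
    ∃ (u : ι → 𝕜) (w : κ → 𝕜), A = Matrix.vecMulVec u w := by
  classical
  obtain ⟨u, -, hu⟩ := finrank_eq_one_iff'.1 hA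
  choose w hw using fun j => hu ⟨A *ᵥ Pi.single j 1, Pi.single j 1, rfl⟩
  refine ⟨u, w, Matrix.ext fun i j => ?_⟩
  have hij : w j * u.1 i = (A *ᵥ Pi.single j 1) i := congrFun (congrArg Subtype.val (hw j)) i
  rw [Matrix.vecMulVec_apply, mul_comm, hij, Matrix.mulVec_single_one, Matrix.col_apply]

theorem rank_vecMulVec_of_ne_zero {ι κ 𝕜 : Type*} [Finite ι] [Fintype κ] [Field 𝕜]
    {u : ι → 𝕜} {w : κ → 𝕜} (h : Matrix.vecMulVec u w ≠ 0) : (Matrix.vecMulVec u w).rank = 1 := by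
  classical
  refine le_antisymm (Matrix.rank_vecMulVec_le u w) (Nat.one_le_iff_ne_zero.2 fun h0 => h ?_)
  rw [Matrix.rank, Submodule.finrank_eq_zero, LinearMap.range_eq_bot] at h0
  refine Matrix.ext_of_mulVec_single fun j => ?_
  rw [← Matrix.mulVecLin_apply, h0, LinearMap.zero_apply, Matrix.zero_mulVec]

theorem exists_fin_sum_eq_sum_of_map_zero {ι β M : Type*} [Fintype ι] [Zero β] [AddCommMonoid M]
    (f : ι → β) {g : β → M} (hg : g 0 = 0) :
    ∃ (N : ℕ) (e : Fin N → ι), (∀ l, f (e l) ≠ 0) ∧ ∑ l, g (f (e l)) = ∑ i, g (f i) := by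
  classical
  let e := Fintype.equivFin {i // f i ≠ 0}
  refine ⟨_, fun l => (e.symm l).1, fun l => (e.symm l).2, ?_⟩
  rw [e.symm.sum_comp fun i : {i // f i ≠ 0} => g (f i)]
  refine Fintype.sum_of_injective Subtype.val Subtype.val_injective _ _ (fun i hi => ?_)
    fun _ => rfl
  have hfi : f i = 0 := by simpa using hi
  rw [hfi, hg]

theorem mem_posCone_iff_exists_eq_sum_vecMulVec_star_self {n : ℕ} {a : Mat n} : a ∈ posCone n ↔
    ∃ (d : ℕ) (v : Fin d → Fin n → ℂ), a = ∑ i, Matrix.vecMulVec (star (v i)) (v i) := by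
  refine Matrix.posSemidef_iff_eq_sum_vecMulVec.trans ?_
  constructor <;> rintro ⟨d, v, rfl⟩ <;> exact ⟨d, fun i => star (v i), by simp only [star_star]⟩

theorem conjTranspose_vecMulVec_mul_mul {k m : ℕ} (u : Fin k → ℂ) (w : Fin m → ℂ) (X : Mat k) :
    (Matrix.vecMulVec u w)ᴴ * X * Matrix.vecMulVec u w =
      gamma k (Matrix.vecMulVec (star u) u) X • Matrix.vecMulVec (star w) w := by
  have hgamma : gamma k (Matrix.vecMulVec (star u) u) X = star u ᵥ* X ⬝ᵥ u := by
    simp only [gamma_apply, Matrix.vecMulVec_apply, dotProduct, Matrix.vecMul, Finset.sum_mul]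
    rw [Finset.sum_comm]
    simp only [mul_right_comm]
  rw [hgamma, Matrix.conjTranspose_vecMulVec, Matrix.vecMulVec_mul, Matrix.vecMulVec_mul_vecMulVec,
    Matrix.vecMulVec_smul]

theorem isMeasureAndPrepare_of_eq_sum_rank_one {k m N : ℕ} {φ : Mat k →ₗ[ℂ] Mat m}
    {A : Fin N → Matrix (Fin k) (Fin m) ℂ} (hA : ∀ l, (A l).rank = 1)
    (hφ : ∀ X, φ X = ∑ l, (A l)ᴴ * X * A l) :
    IsMeasureAndPrepare (posCone k) (posCone m) φ := by
  choose u w huw using fun l => exists_eq_vecMulVec_of_rank_eq_one (hA l)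
  refine ⟨N, fun l => gamma k (Matrix.vecMulVec (star (u l)) (u l)),
    fun l => Matrix.vecMulVec (star (w l)) (w l), fun l => ?_, fun l => ?_, fun X => ?_⟩
  · exact isPositiveFunctional_gamma_iff.2 (Matrix.posSemidef_vecMulVec_star_self _)
  · exact Matrix.posSemidef_vecMulVec_star_self _
  · simp only [hφ, huw, conjTranspose_vecMulVec_mul_mul]

theorem IsMeasureAndPrepare.exists_eq_sum_rank_one {k m : ℕ} {φ : Mat k →ₗ[ℂ] Mat m}
    (h : IsMeasureAndPrepare (posCone k) (posCone m) φ) :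
    ∃ (N : ℕ) (A : Fin N → Matrix (Fin k) (Fin m) ℂ),
      (∀ l, (A l).rank = 1) ∧ ∀ X, φ X = ∑ l, (A l)ᴴ * X * A l := by
  obtain ⟨K, s, P, hs, hP, hφ⟩ := h
  have hgamma : ∀ l, (gamma k).symm (s l) ∈ posCone k := fun l => by
    rw [← isPositiveFunctional_gamma_iff, LinearEquiv.apply_symm_apply]
    exact hs l
  choose d u hu using fun l => mem_posCone_iff_exists_eq_sum_vecMulVec_star_self.1 (hgamma l)
  choose e w hw using fun l => mem_posCone_iff_exists_eq_sum_vecMulVec_star_self.1 (hP l)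
  let A (t : Σ l, Fin (d l) × Fin (e l)) : Matrix (Fin k) (Fin m) ℂ :=
    Matrix.vecMulVec (u t.1 t.2.1) (w t.1 t.2.2)
  have hsum : ∀ X, φ X = ∑ t, (A t)ᴴ * X * A t := fun X => by
    rw [hφ, Fintype.sum_sigma]
    refine Finset.sum_congr rfl fun l _ => ?_
    have hsl : s l X = ∑ i, gamma k (Matrix.vecMulVec (star (u l i)) (u l i)) X := by
      rw [← LinearMap.sum_apply, ← map_sum, ← hu l, LinearEquiv.apply_symm_apply]
    simp only [A, conjTranspose_vecMulVec_mul_mul, Fintype.sum_prod_type]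
    rw [hsl, hw l, Finset.sum_smul_sum]
  obtain ⟨N, c, hc, hcA⟩ := exists_fin_sum_eq_sum_of_map_zero A
    (g := fun B (X : Mat k) => Bᴴ * X * B) (by ext; simp)
  refine ⟨N, fun l => A (c l), fun l => rank_vecMulVec_of_ne_zero (hc l), fun X => ?_⟩
  rw [hsum]
  simpa only [Finset.sum_apply] using (congrFun hcA X).symm

end RankOne

end OpSys

theorem theorem5 (k m : ℕ) (φ : OpSys.Mat k →ₗ[ℂ] OpSys.Mat m) :
    [ OpSys.IsCompletelyPositive (OpSys.ominCone k) (OpSys.stdCone m) φ,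
      OpSys.IsEntanglementBreaking φ,
      OpSys.IsCoEntanglementBreaking φ,
      OpSys.IsCompletelyPositive (OpSys.stdCone k) (OpSys.omaxCone m) φ,
      ∃ (K : ℕ) (s : Fin K → OpSys.Mat k →ₗ[ℂ] ℂ) (P : Fin K → OpSys.Mat m),
        (∀ l, OpSys.IsPositiveFunctional (OpSys.posCone k) (s l)) ∧
        (∀ l, (P l).PosSemidef) ∧
        ∀ X, φ X = ∑ l, s l X • P l,
      ∃ (N : ℕ) (A : Fin N → Matrix (Fin k) (Fin m) ℂ),
        (∀ l, (A l).rank = 1) ∧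
        ∀ X, φ X = ∑ l, (A l).conjTranspose * X * A l,
      OpSys.IsCompletelyPositive (OpSys.ominCone k) (OpSys.omaxCone m) φ ].TFAE := by
  rw [OpSys.omaxCone_eq_dMax]
  tfae_have 5 → 7 :=
    OpSys.IsMeasureAndPrepare.isCompletelyPositive_cMin_dMax
      (P := OpSys.posCone k) (Q := OpSys.posCone m)
  tfae_have 7 → 1 := fun h n A hA => OpSys.dMax_posCone_subset_stdCone n m (h n A hA)
  tfae_have 7 → 4 := fun h n A hA => h n A (OpSys.stdCone_subset_ominCone n k hA)
  tfae_have 4 → 5 := OpSys.isMeasureAndPrepare_of_isCompletelyPositive_stdCone_dMax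
  tfae_have 1 → 5 := OpSys.isMeasureAndPrepare_of_isCompletelyPositive_ominCone_stdCone
  tfae_have 5 → 2 := OpSys.IsMeasureAndPrepare.isEntanglementBreaking
  tfae_have 2 → 1 := OpSys.IsEntanglementBreaking.isCompletelyPositive_ominCone_stdCone
  tfae_have 5 → 3 := fun h => (OpSys.IsMeasureAndPrepare.flat h).isEntanglementBreaking
  tfae_have 3 → 5 := fun h => by
    rw [← OpSys.flat_flat φ]
    exact (OpSys.isMeasureAndPrepare_of_isCompletelyPositive_ominCone_stdCone
      (OpSys.IsEntanglementBreaking.isCompletelyPositive_ominCone_stdCone h)).flat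
  tfae_have 5 → 6 := OpSys.IsMeasureAndPrepare.exists_eq_sum_rank_one
  tfae_have 6 → 5 := fun ⟨_, _, hA, hφ⟩ => OpSys.isMeasureAndPrepare_of_eq_sum_rank_one hA hφ
  tfae_finish
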